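/- Let $(M,\langle\cdot,\cdot\rangle)$ be a smooth Riemannian manifold without boundary, with Levi-Civita connection $\nabla$ and curvature tensor $R(X,Y)Z=\nabla_X\nabla_YZ-\nabla_Y\nabla_XZ-\nabla_{[X,Y]}Z$, and let $S$ be a smooth symmetric $(1,1)$-tensor on $M$ (that is, $\langle SX,Y\rangle=\langle X,SY\rangle$). Put $$Q(X,Y,Z,V)=\langle Y,Z\rangle\langle X,V\rangle-\langle X,Z\rangle\langle Y,V\rangle,\qquad \sigma_{24}(X,Y,Z,V)=(X,V,Z,Y),$$ and let $\theta$ be the $1$-form obtained by contracting $(Q\circ\sigma_{24})\otimes g^{*}$ with $\nabla S\otimes S$, that is, for a local orthonormal frame $\{e_i\}$, $$\theta(X)=\sum_{i,j,k}(Q\circ\sigma_{24})(e_i,e_j,e_k,X)\,\langle(\nabla_{e_i}S)e_j,\,Se_k\rangle .$$ Define $$(RS)(X,Y,Z)=R(X,Y)SZ-S(R(X,Y)Z),\qquad T(X)=-\operatorname{trace}(RS)(\cdot,X,\cdot)=-\sum_i(RS)(e_i,X,e_i),$$ $$W(X,Y)=(\nabla_XS)Y-(\nabla_YS)X,\qquad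 \operatorname{div}S=\operatorname{trace}\nabla S=\sum_i(\nabla_{e_i}S)e_i,\qquad \operatorname{div}\theta=\sum_i(\nabla_{e_i}\theta)(e_i),$$ and let $\langle T,S\rangle=\sum_i\langle Te_i,Se_i\rangle$, $|\nabla S|^2=\sum_{i,j}|(\nabla_{e_i}S)e_j|^2$, $|W|^2=\sum_{i,j}|W(e_i,e_j)|^2$. Then $\theta$ is smooth, and at every point of $M$ $$\operatorname{div}\theta=\langle T,S\rangle+|\operatorname{div}S|^2-|\nabla S|^2+\tfrac12|W|^2 .$$ -/

import Mathlib

open Bundle FiberBundle VectorField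
open scoped Manifold ContDiff

set_option linter.unusedSectionVars false

noncomputable section

namespace RiemannianBochner

variable {E : Type*} [NormedAddCommGroup E] [NormedSpace ℝ E] [FiniteDimensional ℝ E]
  {H : Type*} [TopologicalSpace H] (I : ModelWithCorners ℝ E H)
  {M : Type*} [TopologicalSpace M] [ChartedSpace H M] [IsManifold I ∞ M]
  [RiemannianBundle (fun x : M ↦ TangentSpace I x)]

instance finiteDimensional_tangentSpace (x : M) : FiniteDimensional ℝ (TangentSpace I x) :=
  inferInstanceAs (FiniteDimensional ℝ E)

instance completeSpace_tangentSpace (x : M) : CompleteSpace (TangentSpace I x) :=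
  FiniteDimensional.complete ℝ (TangentSpace I x)

/-- An orthonormal basis of the tangent space at `x`. -/
def frame (x : M) :
    OrthonormalBasis (Fin (Module.finrank ℝ (TangentSpace I x))) ℝ (TangentSpace I x) :=
  stdOrthonormalBasis ℝ (TangentSpace I x)

/-! ### The Levi-Civita connection -/

/-- The right-hand side of the Koszul formula: `⟨∇_X Y, Z⟩` at the point `x`. -/
def koszul (Y X Z : Π x : M, TangentSpace I x) (x : M) : ℝ :=
  (mvfderiv I (fun y ↦ inner ℝ (Y y) (Z y)) x (X x)
    + mvfderiv I (fun y ↦ inner ℝ (X y) (Z y)) x (Y x)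
    - mvfderiv I (fun y ↦ inner ℝ (X y) (Y y)) x (Z x)
    + inner ℝ (mlieBracket I X Y x) (Z x)
    - inner ℝ (mlieBracket I X Z x) (Y x)
    - inner ℝ (mlieBracket I Y Z x) (X x)) / 2

variable [IsContMDiffRiemannianBundle I ∞ E (fun x : M ↦ TangentSpace I x)]

variable {I}

theorem mdiffAt_inner {X Y : Π x : M, TangentSpace I x} {x : M}
    (hX : MDiffAt (T% X) x) (hY : MDiffAt (T% Y) x) :
    MDiffAt (fun y ↦ inner ℝ (X y) (Y y)) x :=
  have : IsContMDiffRiemannianBundle I 1 E (fun x : M ↦ TangentSpace I x) := inferInstance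
  MDifferentiableAt.inner_bundle (E := fun x : M ↦ TangentSpace I x) (F := E) (IB := I) hX hY

theorem mvfderiv_inner_smul_left {f : M → ℝ} {X Y : Π x : M, TangentSpace I x} {x : M}
    (hf : MDiffAt f x) (hX : MDiffAt (T% X) x) (hY : MDiffAt (T% Y) x) :
    mvfderiv I (fun y ↦ inner ℝ ((f • X) y) (Y y)) x
      = f x • mvfderiv I (fun y ↦ inner ℝ (X y) (Y y)) x
        + inner ℝ (X x) (Y x) • mvfderiv I f x := by
  rw [← mvfderiv_fun_mul hf (mdiffAt_inner hX hY)]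
  congr 1
  ext y
  simp [inner_smul_left]

theorem mvfderiv_inner_add_left {X X' Y : Π x : M, TangentSpace I x} {x : M}
    (hX : MDiffAt (T% X) x) (hX' : MDiffAt (T% X') x) (hY : MDiffAt (T% Y) x) :
    mvfderiv I (fun y ↦ inner ℝ ((X + X') y) (Y y)) x
      = mvfderiv I (fun y ↦ inner ℝ (X y) (Y y)) x
        + mvfderiv I (fun y ↦ inner ℝ (X' y) (Y y)) x := by
  rw [← mvfderiv_fun_add (mdiffAt_inner hX hY) (mdiffAt_inner hX' hY)]
  congr 1
  ext y
  simp [inner_add_left]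

theorem mvfderiv_inner_comm (X Y : Π x : M, TangentSpace I x) (x : M) :
    mvfderiv I (fun y ↦ inner ℝ (X y) (Y y)) x = mvfderiv I (fun y ↦ inner ℝ (Y y) (X y)) x := by
  simp only [real_inner_comm]

theorem koszul_tensorial_left {Y Z : Π x : M, TangentSpace I x} {x : M}
    (hY : MDiffAt (T% Y) x) (hZ : MDiffAt (T% Z) x) :
    TensorialAt I E (fun X ↦ koszul I Y X Z x) x where
  smul {f X} hf hX := by
    simp only [koszul, mvfderiv_inner_smul_left hf hX hZ, mvfderiv_inner_smul_left hf hX hY,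
      mlieBracket_smul_left hf hX]
    simp [inner_add_left, inner_smul_left, inner_smul_right]
    ring
  add {X X'} hX hX' := by
    simp only [koszul, mvfderiv_inner_add_left hX hX' hZ, mvfderiv_inner_add_left hX hX' hY,
      mlieBracket_add_left hX hX']
    simp [inner_add_left, inner_add_right]
    ring

theorem koszul_tensorial_right {Y X : Π x : M, TangentSpace I x} {x : M}
    (hY : MDiffAt (T% Y) x) (hX : MDiffAt (T% X) x) :
    TensorialAt I E (fun Z ↦ koszul I Y X Z x) x where
  smul {f Z} hf hZ := by
    simp only [koszul, mvfderiv_inner_comm Y (f • Z), mvfderiv_inner_comm X (f • Z),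
      mvfderiv_inner_comm Y Z, mvfderiv_inner_comm X Z, mvfderiv_inner_smul_left hf hZ hX,
      mvfderiv_inner_smul_left hf hZ hY, mlieBracket_smul_right hf hZ]
    simp [inner_add_left, inner_smul_left, inner_smul_right]
    ring
  add {Z Z'} hZ hZ' := by
    simp only [koszul, mvfderiv_inner_comm Y (Z + Z'), mvfderiv_inner_comm X (Z + Z'),
      mvfderiv_inner_comm Y Z, mvfderiv_inner_comm X Z, mvfderiv_inner_comm Y Z',
      mvfderiv_inner_comm X Z', mvfderiv_inner_add_left hZ hZ' hX,
      mvfderiv_inner_add_left hZ hZ' hY, mlieBracket_add_right hZ hZ']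
    simp [inner_add_left, inner_add_right]
    ring

theorem koszul_add {Y Y' X Z : Π x : M, TangentSpace I x} {x : M} (hY : MDiffAt (T% Y) x)
    (hY' : MDiffAt (T% Y') x) (hX : MDiffAt (T% X) x) (hZ : MDiffAt (T% Z) x) :
    koszul I (Y + Y') X Z x = koszul I Y X Z x + koszul I Y' X Z x := by
  simp only [koszul, mvfderiv_inner_comm X (Y + Y'), mvfderiv_inner_comm X Y,
    mvfderiv_inner_comm X Y', mvfderiv_inner_add_left hY hY' hX,
    mvfderiv_inner_add_left hY hY' hZ, mlieBracket_add_right hY hY', mlieBracket_add_left hY hY']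
  simp [inner_add_left, inner_add_right]
  ring

theorem koszul_smul {Y X Z : Π x : M, TangentSpace I x} {f : M → ℝ} {x : M}
    (hY : MDiffAt (T% Y) x) (hf : MDiffAt f x) (hX : MDiffAt (T% X) x) (hZ : MDiffAt (T% Z) x) :
    koszul I (f • Y) X Z x
      = f x * koszul I Y X Z x + mvfderiv I f x (X x) * inner ℝ (Y x) (Z x) := by
  simp only [koszul, mvfderiv_inner_comm X (f • Y), mvfderiv_inner_comm X Y,
    mvfderiv_inner_smul_left hf hY hX, mvfderiv_inner_smul_left hf hY hZ,
    mlieBracket_smul_right hf hY, mlieBracket_smul_left hf hY]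
  simp [inner_add_left, inner_smul_left, inner_smul_right]
  ring

variable (I) in
/-- For a vector field `Y` differentiable at `x`, the bilinear form `(u, w) ↦ ⟨∇_u Y, w⟩` on the
tangent space at `x`, given by the Koszul formula. -/
def koszulForm (Y : Π x : M, TangentSpace I x) (x : M) (hY : MDiffAt (T% Y) x) :
    TangentSpace I x →L[ℝ] TangentSpace I x →L[ℝ] ℝ :=
  TensorialAt.mkHom₂ (fun X Z ↦ koszul I Y X Z x) x
    (fun _ hZ ↦ koszul_tensorial_left hY hZ) (fun _ hX ↦ koszul_tensorial_right hY hX)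

open scoped Classical in
variable (I) in
/-- `∇Y` at `x`: the vector `∇_u Y` represents the linear form `w ↦ ⟨∇_u Y, w⟩`. The value is `0`
at points where `Y` is not differentiable. -/
def leviCivitaFun (Y : Π x : M, TangentSpace I x) (x : M) :
    TangentSpace I x →L[ℝ] TangentSpace I x :=
  if hY : MDiffAt (T% Y) x then
    ∑ i, ((koszulForm I Y x hY).flip (frame I x i)).smulRight (frame I x i)
  else 0

theorem leviCivitaFun_apply {Y : Π x : M, TangentSpace I x} {x : M} (hY : MDiffAt (T% Y) x)
    (u w : TangentSpace I x) :
    inner ℝ (leviCivitaFun I Y x u) w = koszul I Y (extend E u) (extend E w) x := by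
  have h : inner ℝ (leviCivitaFun I Y x u) w = koszulForm I Y x hY u w := by
    conv_rhs => rw [← (frame I x).sum_repr' w]
    simp [leviCivitaFun, hY, sum_inner, inner_smul_left, mul_comm]
  rw [h]
  rfl

variable (I M) in
/-- The Levi-Civita connection. -/
def leviCivita : CovariantDerivative I E (TangentSpace I : M → Type _) where
  toFun := leviCivitaFun I
  isCovariantDerivativeOnUniv :=
    { add := by
        intro Y Y' x hY hY' _
        ext u
        refine ext_inner_right ℝ fun w ↦ ?_
        have hYY := mdifferentiableAt_add_section hY hY'
        simp [inner_add_left, leviCivitaFun_apply hY, leviCivitaFun_apply hY',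
          leviCivitaFun_apply hYY, koszul_add hY hY' (mdifferentiableAt_extend ..)
            (mdifferentiableAt_extend ..)]
      leibniz := by
        intro Y f x hY hf _
        ext u
        refine ext_inner_right ℝ fun w ↦ ?_
        have hYY := hf.smul_section hY
        simp [inner_add_left, inner_smul_left, leviCivitaFun_apply hY,
          leviCivitaFun_apply hYY, koszul_smul hY hf (mdifferentiableAt_extend ..)
            (mdifferentiableAt_extend ..)] }

theorem inner_leviCivita {X Y Z : Π x : M, TangentSpace I x} {x : M} (hX : MDiffAt (T% X) x)
    (hY : MDiffAt (T% Y) x) (hZ : MDiffAt (T% Z) x) :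
    inner ℝ (leviCivita I M Y x (X x)) (Z x) = koszul I Y X Z x :=
  (leviCivitaFun_apply hY (X x) (Z x)).trans <|
    TensorialAt.mkHom₂_apply (fun _ h ↦ koszul_tensorial_left hY h)
      (fun _ h ↦ koszul_tensorial_right hY h) hX hZ

/-- The Levi-Civita connection is compatible with the metric. -/
theorem leviCivita_metric {X Y Z : Π x : M, TangentSpace I x} {x : M} (hX : MDiffAt (T% X) x)
    (hY : MDiffAt (T% Y) x) (hZ : MDiffAt (T% Z) x) :
    mvfderiv I (fun y ↦ inner ℝ (Y y) (Z y)) x (X x)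
      = inner ℝ (leviCivita I M Y x (X x)) (Z x) + inner ℝ (Y x) (leviCivita I M Z x (X x)) := by
  rw [real_inner_comm _ (Y x), inner_leviCivita hX hY hZ, inner_leviCivita hX hZ hY]
  simp only [koszul, mvfderiv_inner_comm Z Y, mlieBracket_swap_apply (V := Z) (W := Y)]
  simp
  ring

/-- The Levi-Civita connection is torsion-free. -/
theorem torsion_leviCivita : (leviCivita I M).torsion = 0 := by
  rw [CovariantDerivative.torsion_eq_zero_iff]
  intro X Y x hX hY
  refine ext_inner_right ℝ fun w ↦ ?_
  have hZ := mdifferentiableAt_extend I E w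
  have h1 := inner_leviCivita hX hY hZ
  have h2 := inner_leviCivita hY hX hZ
  simp only [extend_apply_self] at h1 h2
  rw [inner_sub_left, h1, h2]
  simp only [koszul, mvfderiv_inner_comm Y X, mlieBracket_swap_apply (V := Y) (W := X)]
  simp
  ring

/-! ### Covariant derivatives of tensors, curvature -/

/-- A field `S` of endomorphisms of the tangent spaces is differentiable at `x` as a section of
the bundle `Hom(TM, TM)`. -/
abbrev MDiffEndAt (S : Π x : M, TangentSpace I x →L[ℝ] TangentSpace I x) (x : M) : Prop :=
  MDifferentiableAt I (I.prod 𝓘(ℝ, E →L[ℝ] E))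
    (fun y ↦ TotalSpace.mk' (E →L[ℝ] E)
      (E := fun y : M ↦ TangentSpace I y →L[ℝ] TangentSpace I y) y (S y)) x

/-- A field `S` of endomorphisms of the tangent spaces, i.e. a `(1,1)`-tensor, is smooth. -/
abbrev SmoothEnd (S : Π x : M, TangentSpace I x →L[ℝ] TangentSpace I x) : Prop :=
  ContMDiff I (I.prod 𝓘(ℝ, E →L[ℝ] E)) ∞
    (fun y ↦ TotalSpace.mk' (E →L[ℝ] E)
      (E := fun y : M ↦ TangentSpace I y →L[ℝ] TangentSpace I y) y (S y))

/-- A `1`-form is differentiable at `x` as a section of the cotangent bundle. -/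
abbrev MDiffFormAt (θ : Π x : M, TangentSpace I x →L[ℝ] ℝ) (x : M) : Prop :=
  MDifferentiableAt I (I.prod 𝓘(ℝ, E →L[ℝ] ℝ))
    (fun y ↦ TotalSpace.mk' (E →L[ℝ] ℝ) (E := fun y : M ↦ TangentSpace I y →L[ℝ] ℝ) y (θ y)) x

/-- A `1`-form is smooth. -/
abbrev SmoothForm (θ : Π x : M, TangentSpace I x →L[ℝ] ℝ) : Prop :=
  ContMDiff I (I.prod 𝓘(ℝ, E →L[ℝ] ℝ)) ∞
    (fun y ↦ TotalSpace.mk' (E →L[ℝ] ℝ) (E := fun y : M ↦ TangentSpace I y →L[ℝ] ℝ) y (θ y))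

theorem covDerivEnd_tensorial {S : Π x : M, TangentSpace I x →L[ℝ] TangentSpace I x} {x : M}
    (hS : MDiffEndAt S x) :
    TensorialAt I E (fun V : Π x : M, TangentSpace I x ↦
      leviCivita I M (fun y ↦ S y (V y)) x - S x ∘L leviCivita I M V x) x where
  smul {f V} hf hV := by
    have hSV : MDiffAt (T% (fun y ↦ S y (V y))) x := hS.clm_bundle_apply hV
    have h : (fun y ↦ S y ((f • V) y)) = f • fun y ↦ S y (V y) := by
      ext y
      simp
    rw [h, (leviCivita I M).isCovariantDerivativeOn.leibniz hSV hf,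
      (leviCivita I M).isCovariantDerivativeOn.leibniz hV hf]
    ext u
    simp
    module
  add {V V'} hV hV' := by
    have hSV : MDiffAt (T% (fun y ↦ S y (V y))) x := hS.clm_bundle_apply hV
    have hSV' : MDiffAt (T% (fun y ↦ S y (V' y))) x := hS.clm_bundle_apply hV'
    have h : (fun y ↦ S y ((V + V') y)) = (fun y ↦ S y (V y)) + fun y ↦ S y (V' y) := by
      ext y
      simp
    rw [h, (leviCivita I M).isCovariantDerivativeOn.add hSV hSV',
      (leviCivita I M).isCovariantDerivativeOn.add hV hV']
    ext u
    simp
    abel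

open scoped Classical in
/-- The covariant derivative of a `(1,1)`-tensor: `covDerivEnd S x u v` is
`(∇_u S) v = ∇_u (S V) - S (∇_u V)` for any `V` differentiable at `x` with `V x = v`
(and `0` where `S` is not differentiable). -/
def covDerivEnd (S : Π x : M, TangentSpace I x →L[ℝ] TangentSpace I x) (x : M) :
    TangentSpace I x →L[ℝ] TangentSpace I x →L[ℝ] TangentSpace I x :=
  if hS : MDiffEndAt S x then
    (TensorialAt.mkHom (fun V : Π x : M, TangentSpace I x ↦
      leviCivita I M (fun y ↦ S y (V y)) x - S x ∘L leviCivita I M V x) x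
      (covDerivEnd_tensorial hS)).flip
  else 0

theorem mdiffAt_form_apply {θ : Π x : M, TangentSpace I x →L[ℝ] ℝ} {x : M}
    (hθ : MDiffFormAt θ x) {V : Π x : M, TangentSpace I x} (hV : MDiffAt (T% V) x) :
    MDiffAt (fun y ↦ θ y (V y)) x := by
  have : MDifferentiableAt I (I.prod 𝓘(ℝ))
      (fun y ↦ TotalSpace.mk' ℝ (E := Bundle.Trivial M ℝ) y (θ y (V y))) x :=
    MDifferentiableAt.clm_bundle_apply (F₁ := E) (E₂ := Bundle.Trivial M ℝ) hθ hV
  simp only [mdifferentiableAt_totalSpace] at this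
  exact this.2

theorem covDerivForm_tensorial {θ : Π x : M, TangentSpace I x →L[ℝ] ℝ} {x : M}
    (hθ : MDiffFormAt θ x) :
    TensorialAt I E (fun V : Π x : M, TangentSpace I x ↦
      mvfderiv I (fun y ↦ θ y (V y)) x - θ x ∘L leviCivita I M V x) x where
  smul {f V} hf hV := by
    have h : mvfderiv I (fun y ↦ θ y ((f • V) y)) x
        = f x • mvfderiv I (fun y ↦ θ y (V y)) x + θ x (V x) • mvfderiv I f x := by
      rw [← mvfderiv_fun_mul hf (mdiffAt_form_apply hθ hV)]
      congr 1
      ext y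
      simp
    rw [h, (leviCivita I M).isCovariantDerivativeOn.leibniz hV hf]
    ext u
    simp
    ring
  add {V V'} hV hV' := by
    have h : mvfderiv I (fun y ↦ θ y ((V + V') y)) x
        = mvfderiv I (fun y ↦ θ y (V y)) x + mvfderiv I (fun y ↦ θ y (V' y)) x := by
      rw [← mvfderiv_fun_add (mdiffAt_form_apply hθ hV) (mdiffAt_form_apply hθ hV')]
      congr 1
      ext y
      simp
    rw [h, (leviCivita I M).isCovariantDerivativeOn.add hV hV']
    ext u
    simp
    ring

open scoped Classical in
/-- The covariant derivative of a `1`-form: `covDerivForm θ x u v` is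
`(∇_u θ) v = u (θ V) - θ (∇_u V)` for any `V` differentiable at `x` with `V x = v`
(and `0` where `θ` is not differentiable). -/
def covDerivForm (θ : Π x : M, TangentSpace I x →L[ℝ] ℝ) (x : M) :
    TangentSpace I x →L[ℝ] TangentSpace I x →L[ℝ] ℝ :=
  if hθ : MDiffFormAt θ x then
    (TensorialAt.mkHom (fun V : Π x : M, TangentSpace I x ↦
      mvfderiv I (fun y ↦ θ y (V y)) x - θ x ∘L leviCivita I M V x) x
      (covDerivForm_tensorial hθ)).flip
  else 0

/-- The vector field `R(X, Y)Z = ∇_X ∇_Y Z - ∇_Y ∇_X Z - ∇_{[X, Y]} Z`. -/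
def curvatureField (X Y Z : Π x : M, TangentSpace I x) (x : M) : TangentSpace I x :=
  leviCivita I M (fun y ↦ leviCivita I M Z y (Y y)) x (X x)
    - leviCivita I M (fun y ↦ leviCivita I M Z y (X y)) x (Y x)
    - leviCivita I M Z x (mlieBracket I X Y x)

/-- The curvature tensor `R(u, v)w` at `x`, computed with vector fields that are smooth near `x`
and take the values `u`, `v`, `w` at `x`. -/
def curvature (x : M) (u v w : TangentSpace I x) : TangentSpace I x :=
  curvatureField (extend E u) (extend E v) (extend E w) x

/-! ### The objects of the formula -/

/-- `Div θ`, the trace of `∇θ`. -/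
def divForm (θ : Π x : M, TangentSpace I x →L[ℝ] ℝ) (x : M) : ℝ :=
  ∑ i, covDerivForm θ x (frame I x i) (frame I x i)

/-- `Div S = trace ∇S`. -/
def divEnd (S : Π x : M, TangentSpace I x →L[ℝ] TangentSpace I x) (x : M) : TangentSpace I x :=
  ∑ i, covDerivEnd S x (frame I x i) (frame I x i)

/-- The squared norm `|A|² = ∑ |A(e_i, e_j)|²` of a vector-valued bilinear form. -/
def normSq₂ (x : M) (A : TangentSpace I x → TangentSpace I x → TangentSpace I x) : ℝ :=
  ∑ i, ∑ j, ‖A (frame I x i) (frame I x j)‖ ^ 2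

/-- The inner product `⟨A, B⟩ = ∑ ⟨A e_i, B e_i⟩` of `(1,1)`-tensors. -/
def inner₁ (x : M) (A B : TangentSpace I x → TangentSpace I x) : ℝ :=
  ∑ i, inner ℝ (A (frame I x i)) (B (frame I x i))

/-- `W(X, Y) = (∇_X S) Y - (∇_Y S) X`. -/
def tensorW (S : Π x : M, TangentSpace I x →L[ℝ] TangentSpace I x) (x : M)
    (u v : TangentSpace I x) : TangentSpace I x :=
  covDerivEnd S x u v - covDerivEnd S x v u

/-- `(RS)(X, Y, Z) = R(X, Y) S Z - S (R(X, Y) Z)`. -/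
def tensorRS (S : Π x : M, TangentSpace I x →L[ℝ] TangentSpace I x) (x : M)
    (u v w : TangentSpace I x) : TangentSpace I x :=
  curvature x u v (S x w) - S x (curvature x u v w)

/-- `T(X) = - trace (RS)(·, X, ·)`. -/
def tensorT (S : Π x : M, TangentSpace I x →L[ℝ] TangentSpace I x) (x : M)
    (u : TangentSpace I x) : TangentSpace I x :=
  -∑ i, tensorRS S x (frame I x i) u (frame I x i)

/-- `Q(X, Y, Z, W) = ⟨Y, Z⟩⟨X, W⟩ - ⟨X, Z⟩⟨Y, W⟩`. -/
def tensorQ (x : M) : TangentSpace I x × TangentSpace I x × TangentSpace I x × TangentSpace I x → ℝ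
  | (X, Y, Z, W) => inner ℝ Y Z * inner ℝ X W - inner ℝ X Z * inner ℝ Y W

/-- The transposition of the second and fourth entries. -/
def sigma24 {V : Type*} : V × V × V × V → V × V × V × V
  | (X, Y, Z, W) => (X, W, Z, Y)

/-- The `1`-form `θ`, the contraction of `(Q ∘ σ₂₄) ⊗ g*` with `∇S ⊗ S`: the first three slots of
`Q ∘ σ₂₄` are contracted with the three arguments of `∇S ⊗ S` in their order, and the two vectors
`(∇_{e_i} S) e_j`, `S e_k` are paired by the metric. -/
def theta (S : Π x : M, TangentSpace I x →L[ℝ] TangentSpace I x) (x : M) :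
    TangentSpace I x →L[ℝ] ℝ :=
  LinearMap.toContinuousLinearMap
    { toFun := fun u ↦ ∑ i, ∑ j, ∑ k,
        (tensorQ x ∘ sigma24) (frame I x i, frame I x j, frame I x k, u)
          * inner ℝ (covDerivEnd S x (frame I x i) (frame I x j)) (S x (frame I x k))
      map_add' := by
        intro u v
        simp only [← Finset.sum_add_distrib]
        refine Finset.sum_congr rfl fun i _ ↦ Finset.sum_congr rfl fun j _ ↦
          Finset.sum_congr rfl fun k _ ↦ ?_
        simp only [Function.comp, sigma24, tensorQ, inner_add_left]
        ring
      map_smul' := by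
        intro c u
        simp only [RingHom.id_apply, smul_eq_mul, Finset.mul_sum]
        refine Finset.sum_congr rfl fun i _ ↦ Finset.sum_congr rfl fun j _ ↦
          Finset.sum_congr rfl fun k _ ↦ ?_
        simp only [Function.comp, sigma24, tensorQ, real_inner_smul_left]
        ring }

end RiemannianBochner

end

noncomputable section

namespace RiemannianBochner

open Filter
open scoped Topology

variable {E : Type*} [NormedAddCommGroup E] [NormedSpace ℝ E] [FiniteDimensional ℝ E]
  {H : Type*} [TopologicalSpace H] {I : ModelWithCorners ℝ E H}
  {M : Type*} [TopologicalSpace M] [ChartedSpace H M] [IsManifold I ∞ M]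
  [RiemannianBundle (fun x : M ↦ TangentSpace I x)]
  [IsContMDiffRiemannianBundle I ∞ E (fun x : M ↦ TangentSpace I x)]

/-! ### Smooth vector fields -/

theorem contMDiffAt_inner {X Y : Π x : M, TangentSpace I x} {x : M}
    (hX : CMDiffAt ∞ (T% X) x) (hY : CMDiffAt ∞ (T% Y) x) :
    CMDiffAt ∞ (fun y ↦ inner ℝ (X y) (Y y)) x :=
  ContMDiffAt.inner_bundle (E := fun x : M ↦ TangentSpace I x) (F := E) (IB := I) hX hY

theorem contMDiffAt_mlieBracket {X Y : Π x : M, TangentSpace I x} {x : M}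
    (hX : CMDiffAt ∞ (T% X) x) (hY : CMDiffAt ∞ (T% Y) x) :
    CMDiffAt ∞ (T% (mlieBracket I X Y)) x := by
  have : IsManifold I (((⊤ : ℕ∞) : ℕ∞ω) + 1) M := inferInstanceAs (IsManifold I ∞ M)
  have : IsManifold I (minSmoothness ℝ 2) M := by
    rw [minSmoothness_of_isRCLikeNormedField]
    infer_instance
  exact ContMDiffAt.mlieBracket_vectorField (m := ⊤) (n := ⊤) hX hY (by simp)

theorem contMDiffAt_mvfderiv_apply {f : M → ℝ} {X : Π x : M, TangentSpace I x} {x : M}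
    (hf : CMDiffAt ∞ f x) (hX : CMDiffAt ∞ (T% X) x) :
    CMDiffAt ∞ (fun y ↦ mvfderiv I f y (X y)) x := by
  have h := ContMDiffAt.clm_apply_of_inCoordinates (n := ∞)
    (E₁ := fun x : M ↦ TangentSpace I x) (E₂ := fun t : ℝ ↦ TangentSpace 𝓘(ℝ, ℝ) t)
    (F₁ := E) (F₂ := ℝ) (b₁ := id) (b₂ := f) (v := X)
    (ϕ := fun y ↦ mfderiv I 𝓘(ℝ, ℝ) f y)
    (hf.mfderiv_const (m := ∞) (by simp)) hX hf
  exact (contMDiff_snd_tangentBundle_modelSpace ℝ 𝓘(ℝ, ℝ)).contMDiffAt.comp x h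

theorem _root_.ContMDiffAt.mdiffAt_section {X : Π x : M, TangentSpace I x} {x : M}
    (hX : CMDiffAt ∞ (T% X) x) : MDiffAt (T% X) x :=
  hX.mdifferentiableAt (by simp)

theorem _root_.ContMDiffAt.eventually_mdiffAt_section {X : Π x : M, TangentSpace I x} {x : M}
    (hX : CMDiffAt ∞ (T% X) x) : ∀ᶠ y in 𝓝 x, MDiffAt (T% X) y :=
  have h1 : CMDiffAt 1 (T% X) x := ContMDiffAt.of_le hX (by simp)
  (contMDiffAt_iff_contMDiffAt_nhds (by simp)).1 h1 |>.mono
    fun _ h ↦ h.mdifferentiableAt one_ne_zero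

theorem contMDiffAt_koszul {Y X Z : Π x : M, TangentSpace I x} {x : M}
    (hY : CMDiffAt ∞ (T% Y) x) (hX : CMDiffAt ∞ (T% X) x) (hZ : CMDiffAt ∞ (T% Z) x) :
    CMDiffAt ∞ (koszul I Y X Z) x := by
  have h1 := contMDiffAt_mvfderiv_apply (contMDiffAt_inner hY hZ) hX
  have h2 := contMDiffAt_mvfderiv_apply (contMDiffAt_inner hX hZ) hY
  have h3 := contMDiffAt_mvfderiv_apply (contMDiffAt_inner hX hY) hZ
  have h4 := contMDiffAt_inner (contMDiffAt_mlieBracket hX hY) hZ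
  have h5 := contMDiffAt_inner (contMDiffAt_mlieBracket hX hZ) hY
  have h6 := contMDiffAt_inner (contMDiffAt_mlieBracket hY hZ) hX
  exact (((((h1.add h2).sub h3).add h4).sub h5).sub h6).div_const 2

/-! ### Local orthonormal frames -/

/-- The vector fields `b i` are smooth at `x` and orthonormal bases of the tangent spaces near `x`. -/
structure IsOrthonormalFrameAt {ι : Type*} [Fintype ι] (b : ι → Π x : M, TangentSpace I x) (x : M) :
    Prop where
  contMDiffAt : ∀ i, CMDiffAt ∞ (T% (b i)) x
  exists_basis : ∀ᶠ y in 𝓝 x, ∃ B : OrthonormalBasis ι ℝ (TangentSpace I y), ∀ i, B i = b i y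

theorem contMDiffAt_gramSchmidt {ι : Type*} [LinearOrder ι] [LocallyFiniteOrderBot ι]
    [WellFoundedLT ι] {F : ι → Π x : M, TangentSpace I x} {x : M}
    (hF : ∀ i, CMDiffAt ∞ (T% (F i)) x) (hx : LinearIndependent ℝ (F · x)) (i : ι) :
    CMDiffAt ∞ (T% (fun y ↦ InnerProductSpace.gramSchmidt ℝ (F · y) i)) x := by
  induction i using WellFoundedLT.induction with
  | ind i ih =>
    have h : (fun y ↦ InnerProductSpace.gramSchmidt ℝ (F · y) i)
        = F i - fun y ↦ ∑ j ∈ Finset.Iio i,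
          ((fun y ↦ inner ℝ (InnerProductSpace.gramSchmidt ℝ (F · y) j) (F i y)
            / inner ℝ (InnerProductSpace.gramSchmidt ℝ (F · y) j)
                (InnerProductSpace.gramSchmidt ℝ (F · y) j))
            • fun y ↦ InnerProductSpace.gramSchmidt ℝ (F · y) j) y := by
      ext y
      rw [InnerProductSpace.gramSchmidt_def]
      simp [Submodule.starProjection_singleton]
    refine (congrArg (fun X : Π x : M, TangentSpace I x ↦ CMDiffAt ∞ (T% X) x) h).mpr ?_
    refine (hF i).sub_section (ContMDiffAt.sum_section fun j hj ↦ ?_)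
    have hj := ih j (Finset.mem_Iio.1 hj)
    refine ContMDiffAt.smul_section ?_ hj
    refine (contMDiffAt_inner hj (hF i)).div₀ (contMDiffAt_inner hj hj) ?_
    simpa using InnerProductSpace.gramSchmidt_ne_zero j hx

theorem contMDiffAt_gramSchmidtNormed {ι : Type*} [LinearOrder ι] [LocallyFiniteOrderBot ι]
    [WellFoundedLT ι] {F : ι → Π x : M, TangentSpace I x} {x : M}
    (hF : ∀ i, CMDiffAt ∞ (T% (F i)) x) (hx : LinearIndependent ℝ (F · x)) (i : ι) :
    CMDiffAt ∞ (T% (fun y ↦ InnerProductSpace.gramSchmidtNormed ℝ (F · y) i)) x := by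
  have h : (fun y ↦ InnerProductSpace.gramSchmidtNormed ℝ (F · y) i)
      = (fun y ↦ (Real.sqrt (inner ℝ (InnerProductSpace.gramSchmidt ℝ (F · y) i)
          (InnerProductSpace.gramSchmidt ℝ (F · y) i)))⁻¹)
        • fun y ↦ InnerProductSpace.gramSchmidt ℝ (F · y) i := by
    ext y
    simp [InnerProductSpace.gramSchmidtNormed]
  refine (congrArg (fun X : Π x : M, TangentSpace I x ↦ CMDiffAt ∞ (T% X) x) h).mpr ?_
  have hi := contMDiffAt_gramSchmidt hF hx i
  have h0 := InnerProductSpace.gramSchmidt_ne_zero i hx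
  refine ContMDiffAt.smul_section ?_ hi
  refine ContMDiffAt.inv₀ ?_ (by simpa [real_inner_self_eq_norm_sq] using h0)
  exact (Real.contDiffAt_sqrt (by simpa using h0)).contMDiffAt.comp x (contMDiffAt_inner hi hi)

theorem exists_isOrthonormalFrameAt (x : M) :
    ∃ b : Fin (Module.finrank ℝ (TangentSpace I x)) → Π x : M, TangentSpace I x,
      IsOrthonormalFrameAt b x ∧ ∀ i, b i x = frame I x i := by
  let e := trivializationAt E (TangentSpace I : M → Type _) x
  have hx : x ∈ e.baseSet := FiberBundle.mem_baseSet_trivializationAt' x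
  let β : Module.Basis (Fin (Module.finrank ℝ (TangentSpace I x))) ℝ E :=
    (frame I x).toBasis.map (e.linearEquivAt ℝ x hx)
  let F := e.localFrame β
  have hF : IsLocalFrameOn I E ∞ F e.baseSet := e.isLocalFrameOn_localFrame_baseSet I ∞ β
  have hFx (i) : F i x = frame I x i := by
    simp [F, hx, Trivialization.basisAt, β]
  refine ⟨fun i y ↦ InnerProductSpace.gramSchmidtNormed ℝ (F · y) i, ⟨fun i ↦ ?_, ?_⟩, fun i ↦ ?_⟩
  · exact contMDiffAt_gramSchmidtNormed (fun j ↦ hF.contMDiffAt e.open_baseSet hx j)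
      (hF.linearIndependent hx) i
  · filter_upwards [e.open_baseSet.mem_nhds hx] with y hy
    have ho := InnerProductSpace.gramSchmidtNormed_orthonormal (hF.linearIndependent hy)
    refine ⟨OrthonormalBasis.mk ho ?_, fun i ↦ congrFun (OrthonormalBasis.coe_mk ..) i⟩
    rw [InnerProductSpace.span_gramSchmidtNormed_range, InnerProductSpace.span_gramSchmidt]
    exact hF.generating hy
  · simp only [InnerProductSpace.gramSchmidtNormed]
    rw [InnerProductSpace.gramSchmidt_of_orthogonal]
    · simp [hFx]
    · intro i j hij
      simpa [hFx] using (frame I x).orthonormal.2 hij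

namespace IsOrthonormalFrameAt

variable {ι : Type*} [Fintype ι] {b : ι → Π x : M, TangentSpace I x} {x : M}

theorem eventually_eq_sum (hb : IsOrthonormalFrameAt b x) (X : Π x : M, TangentSpace I x) :
    ∀ᶠ y in 𝓝 x, X y = ∑ i, inner ℝ (X y) (b i y) • b i y := by
  filter_upwards [hb.exists_basis] with y ⟨B, hB⟩
  simp_rw [← hB, real_inner_comm (B _)]
  exact (B.sum_repr' (X y)).symm

theorem contMDiffAt_of_inner (hb : IsOrthonormalFrameAt b x) {X : Π x : M, TangentSpace I x}
    (h : ∀ i, CMDiffAt ∞ (fun y ↦ inner ℝ (X y) (b i y)) x) : CMDiffAt ∞ (T% X) x := by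
  have h1 : CMDiffAt ∞ (T% (fun y ↦ ∑ i, ((fun y ↦ inner ℝ (X y) (b i y)) • b i) y)) x :=
    ContMDiffAt.sum_section fun i _ ↦ (h i).smul_section (hb.contMDiffAt i)
  refine h1.congr_of_eventuallyEq ?_
  filter_upwards [hb.eventually_eq_sum X] with y hy
  simpa using hy

end IsOrthonormalFrameAt

theorem contMDiffAt_leviCivita {X Y : Π x : M, TangentSpace I x} {x : M}
    (hX : CMDiffAt ∞ (T% X) x) (hY : CMDiffAt ∞ (T% Y) x) :
    CMDiffAt ∞ (T% (fun y ↦ leviCivita I M Y y (X y))) x := by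
  obtain ⟨b, hb, -⟩ := exists_isOrthonormalFrameAt (I := I) x
  refine hb.contMDiffAt_of_inner fun i ↦ ?_
  refine (contMDiffAt_koszul hY hX (hb.contMDiffAt i)).congr_of_eventuallyEq ?_
  filter_upwards [hX.eventually_mdiffAt_section, hY.eventually_mdiffAt_section,
    (hb.contMDiffAt i).eventually_mdiffAt_section] with y h1 h2 h3
  exact inner_leviCivita h1 h2 h3

/-! ### Tensoriality of the curvature -/

theorem eq_of_apply_eq {A : Type*} [AddCommGroup A] [Module ℝ A]
    {Φ : (Π x : M, TangentSpace I x) → A} {x : M}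
    (hcongr : ∀ {X X' : Π x : M, TangentSpace I x}, CMDiffAt ∞ (T% X) x → CMDiffAt ∞ (T% X') x →
      X =ᶠ[𝓝 x] X' → Φ X = Φ X')
    (hadd : ∀ {X X' : Π x : M, TangentSpace I x}, CMDiffAt ∞ (T% X) x → CMDiffAt ∞ (T% X') x →
      Φ (X + X') = Φ X + Φ X')
    (hsmul : ∀ {f : M → ℝ} {X : Π x : M, TangentSpace I x}, CMDiffAt ∞ f x →
      CMDiffAt ∞ (T% X) x → Φ (f • X) = f x • Φ X)
    {X X' : Π x : M, TangentSpace I x} (hX : CMDiffAt ∞ (T% X) x) (hX' : CMDiffAt ∞ (T% X') x)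
    (h : X x = X' x) : Φ X = Φ X' := by
  classical
  obtain ⟨b, hb, -⟩ := exists_isOrthonormalFrameAt (I := I) x
  have key {X : Π x : M, TangentSpace I x} (hX : CMDiffAt ∞ (T% X) x) :
      Φ X = ∑ i, inner ℝ (X x) (b i x) • Φ (b i) := by
    have hs (i) : CMDiffAt ∞ (T% ((fun y ↦ inner ℝ (X y) (b i y)) • b i)) x :=
      (contMDiffAt_inner hX (hb.contMDiffAt i)).smul_section (hb.contMDiffAt i)
    have hsum (s : Finset (Fin (Module.finrank ℝ (TangentSpace I x)))) :
        CMDiffAt ∞ (T% (∑ i ∈ s, (fun y ↦ inner ℝ (X y) (b i y)) • b i)) x ∧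
        Φ (∑ i ∈ s, (fun y ↦ inner ℝ (X y) (b i y)) • b i)
          = ∑ i ∈ s, inner ℝ (X x) (b i x) • Φ (b i) := by
      induction s using Finset.induction_on with
      | empty =>
        have h0 : ((0 : M → ℝ) • X) = 0 := by ext y; simp
        have hc : CMDiffAt ∞ (0 : M → ℝ) x := contMDiffAt_const
        simp only [Finset.sum_empty]
        rw [← h0]
        exact ⟨hc.smul_section hX, by rw [hsmul hc hX]; simp⟩
      | insert a s ha ih =>
        simp only [Finset.sum_insert ha]
        refine ⟨(hs a).add_section ih.1, ?_⟩
        rw [hadd (hs a) ih.1, ih.2, hsmul (contMDiffAt_inner hX (hb.contMDiffAt a))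
          (hb.contMDiffAt a)]
    rw [← (hsum Finset.univ).2]
    refine hcongr hX (hsum _).1 ?_
    filter_upwards [hb.eventually_eq_sum X] with y hy
    refine hy.trans ?_
    rw [Finset.sum_apply]
    rfl
  rw [key hX, key hX', h]

theorem mvfderiv_mlieBracket {f : M → ℝ} {X Y : Π x : M, TangentSpace I x} {x : M}
    (hf : CMDiffAt ∞ f x) (hX : CMDiffAt ∞ (T% X) x) (hY : CMDiffAt ∞ (T% Y) x) :
    mvfderiv I f x (mlieBracket I X Y x)
      = mvfderiv I (fun y ↦ mvfderiv I f y (Y y)) x (X x)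
        - mvfderiv I (fun y ↦ mvfderiv I f y (X y)) x (Y x) := by
  rcases subsingleton_or_nontrivial (TangentSpace I x) with hT | hT
  · simp [Subsingleton.elim (mlieBracket I X Y x) 0, Subsingleton.elim (X x) 0,
      Subsingleton.elim (Y x) 0]
  obtain ⟨w, hw⟩ := exists_ne (0 : TangentSpace I x)
  let Z := extend E w
  have hZ : CMDiffAt ∞ (T% Z) x := contMDiffAt_extend ..
  have hZx : Z x = w := extend_apply_self ..
  have hM : IsManifold I (minSmoothness ℝ 3) M := by
    rw [minSmoothness_of_isRCLikeNormedField]; infer_instance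
  have h2 {X : Π x : M, TangentSpace I x} (hX : CMDiffAt ∞ (T% X) x) :
      CMDiffAt (minSmoothness ℝ 2) (T% X) x := by
    rw [minSmoothness_of_isRCLikeNormedField]
    exact ContMDiffAt.of_le hX ENat.LEInfty.out
  have hfd : ∀ᶠ y in 𝓝 x, MDiffAt f y :=
    (contMDiffAt_iff_contMDiffAt_nhds (n := 1) (by simp)).1 (hf.of_le (by simp)) |>.mono
      fun _ h ↦ h.mdifferentiableAt one_ne_zero
  have hsm {X : Π x : M, TangentSpace I x} : mlieBracket I X (f • Z)
      =ᶠ[𝓝 x] (fun y ↦ mvfderiv I f y (X y)) • Z + f • mlieBracket I X Z := by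
    filter_upwards [hfd, hZ.eventually_mdiffAt_section] with y h1 h2
    exact mlieBracket_smul_right h1 h2
  have hexp {X Y : Π x : M, TangentSpace I x} (hX : CMDiffAt ∞ (T% X) x)
      (hY : CMDiffAt ∞ (T% Y) x) : mlieBracket I X (mlieBracket I Y (f • Z)) x
      = mvfderiv I (fun y ↦ mvfderiv I f y (Y y)) x (X x) • w
        + mvfderiv I f x (Y x) • mlieBracket I X Z x
        + (mvfderiv I f x (X x) • mlieBracket I Y Z x
        + f x • mlieBracket I X (mlieBracket I Y Z) x) := by
    have h1 := contMDiffAt_mvfderiv_apply hf hY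
    have h3 := contMDiffAt_mlieBracket hY hZ
    rw [EventuallyEq.rfl.mlieBracket_vectorField_eq hsm,
      mlieBracket_add_right (h1.smul_section hZ).mdiffAt_section
        (hf.smul_section h3).mdiffAt_section,
      mlieBracket_smul_right (h1.mdifferentiableAt (by simp)) hZ.mdiffAt_section,
      mlieBracket_smul_right hfd.self_of_nhds h3.mdiffAt_section, hZx]
  have hJ := leibniz_identity_mlieBracket_apply (h2 hX) (h2 hY) (h2 (hf.smul_section hZ))
  have hJ' := leibniz_identity_mlieBracket_apply (h2 hX) (h2 hY) (h2 hZ)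
  rw [hexp hX hY, hexp hY hX, mlieBracket_smul_right hfd.self_of_nhds hZ.mdiffAt_section, hJ',
    hZx] at hJ
  have h0 : (mvfderiv I f x (mlieBracket I X Y x)
      - (mvfderiv I (fun y ↦ mvfderiv I f y (Y y)) x (X x)
        - mvfderiv I (fun y ↦ mvfderiv I f y (X y)) x (Y x))) • w = 0 := by
    rw [← sub_eq_zero] at hJ
    rw [← neg_eq_zero, ← hJ]
    module
  exact sub_eq_zero.1 ((smul_eq_zero.1 h0).resolve_right hw)

theorem leviCivita_congr {Y Y' : Π x : M, TangentSpace I x} {x : M} (hY : MDiffAt (T% Y) x)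
    (hY' : MDiffAt (T% Y') x) (h : Y =ᶠ[𝓝 x] Y') : leviCivita I M Y x = leviCivita I M Y' x :=
  (leviCivita I M).isCovariantDerivativeOn.congr_of_eventuallyEq hY hY' univ_mem h

theorem leviCivita_add {Y Y' : Π x : M, TangentSpace I x} {x : M} (hY : MDiffAt (T% Y) x)
    (hY' : MDiffAt (T% Y') x) :
    leviCivita I M (Y + Y') x = leviCivita I M Y x + leviCivita I M Y' x :=
  (leviCivita I M).isCovariantDerivativeOn.add hY hY'

theorem leviCivita_smul {f : M → ℝ} {Y : Π x : M, TangentSpace I x} {x : M} (hf : MDiffAt f x)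
    (hY : MDiffAt (T% Y) x) :
    leviCivita I M (f • Y) x = f x • leviCivita I M Y x + (mvfderiv I f x).smulRight (Y x) :=
  (leviCivita I M).isCovariantDerivativeOn.leibniz hY hf

theorem mlieBracket_eq_leviCivita_sub {X Y : Π x : M, TangentSpace I x} {x : M}
    (hX : MDiffAt (T% X) x) (hY : MDiffAt (T% Y) x) :
    mlieBracket I X Y x = leviCivita I M Y x (X x) - leviCivita I M X x (Y x) :=
  ((CovariantDerivative.torsion_eq_zero_iff _).1 torsion_leviCivita hX hY).symm

theorem curvatureField_swap (X Y Z : Π x : M, TangentSpace I x) (x : M) :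
    curvatureField X Y Z x = -curvatureField Y X Z x := by
  rw [curvatureField, curvatureField, mlieBracket_swap_apply (V := X) (W := Y), map_neg]
  abel

theorem curvatureField_congr_left {X X' Y Z : Π x : M, TangentSpace I x} {x : M}
    (hX : CMDiffAt ∞ (T% X) x) (hX' : CMDiffAt ∞ (T% X') x)
    (hZ : CMDiffAt ∞ (T% Z) x) (h : X x = X' x) :
    curvatureField X Y Z x = curvatureField X' Y Z x := by
  refine eq_of_apply_eq (Φ := fun X ↦ curvatureField X Y Z x) ?_ ?_ ?_ hX hX' h
  · intro X X' hX hX' h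
    have hb : mlieBracket I X Y x = mlieBracket I X' Y x := h.mlieBracket_vectorField_eq .rfl
    simp only [curvatureField]
    rw [hb, h.self_of_nhds,
      leviCivita_congr (contMDiffAt_leviCivita hX hZ).mdiffAt_section
      (contMDiffAt_leviCivita hX' hZ).mdiffAt_section (h.mono fun y hy ↦ congrArg (leviCivita I M Z y) hy)]
  · intro X X' hX hX'
    have h1 := leviCivita_add (contMDiffAt_leviCivita hX hZ).mdiffAt_section
      (contMDiffAt_leviCivita hX' hZ).mdiffAt_section
    have h2 : (fun y ↦ leviCivita I M Z y ((X + X') y))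
        = (fun y ↦ leviCivita I M Z y (X y)) + fun y ↦ leviCivita I M Z y (X' y) := by
      ext y; simp
    simp only [curvatureField, h2, h1, mlieBracket_add_left hX.mdiffAt_section hX'.mdiffAt_section]
    simp
    abel
  · intro f X hf hX
    have hf' := hf.mdifferentiableAt (by simp)
    have h1 := leviCivita_smul hf' (contMDiffAt_leviCivita hX hZ).mdiffAt_section
    have h2 : (fun y ↦ leviCivita I M Z y ((f • X) y))
        = f • (fun y ↦ leviCivita I M Z y (X y)) := by
      ext y; simp
    simp only [curvatureField, h2, h1, mlieBracket_smul_left hf' hX.mdiffAt_section]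
    simp
    module

theorem curvatureField_congr_right {X Y Z Z' : Π x : M, TangentSpace I x} {x : M}
    (hX : CMDiffAt ∞ (T% X) x) (hY : CMDiffAt ∞ (T% Y) x)
    (hZ : CMDiffAt ∞ (T% Z) x) (hZ' : CMDiffAt ∞ (T% Z') x) (h : Z x = Z' x) :
    curvatureField X Y Z x = curvatureField X Y Z' x := by
  refine eq_of_apply_eq (Φ := fun Z ↦ curvatureField X Y Z x) ?_ ?_ ?_ hZ hZ' h
  · intro Z Z' hZ hZ' h
    have h1 {X : Π x : M, TangentSpace I x} (hX : CMDiffAt ∞ (T% X) x) :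
        leviCivita I M (fun y ↦ leviCivita I M Z y (X y)) x
          = leviCivita I M (fun y ↦ leviCivita I M Z' y (X y)) x := by
      refine leviCivita_congr (contMDiffAt_leviCivita hX hZ).mdiffAt_section
        (contMDiffAt_leviCivita hX hZ').mdiffAt_section ?_
      filter_upwards [h.eventuallyEq_nhds, hZ.eventually_mdiffAt_section,
        hZ'.eventually_mdiffAt_section] with y h1 h2 h3
      rw [leviCivita_congr h2 h3 h1]
    simp only [curvatureField, h1 hX, h1 hY,
      leviCivita_congr hZ.mdiffAt_section hZ'.mdiffAt_section h]
  · intro Z Z' hZ hZ'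
    have h1 {X : Π x : M, TangentSpace I x} (hX : CMDiffAt ∞ (T% X) x) :
        leviCivita I M (fun y ↦ leviCivita I M (Z + Z') y (X y)) x
          = leviCivita I M (fun y ↦ leviCivita I M Z y (X y)) x
            + leviCivita I M (fun y ↦ leviCivita I M Z' y (X y)) x := by
      rw [← leviCivita_add (contMDiffAt_leviCivita hX hZ).mdiffAt_section
        (contMDiffAt_leviCivita hX hZ').mdiffAt_section]
      refine leviCivita_congr (contMDiffAt_leviCivita hX (hZ.add_section hZ')).mdiffAt_section
        ((contMDiffAt_leviCivita hX hZ).add_section (contMDiffAt_leviCivita hX hZ')).mdiffAt_section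
        ?_
      filter_upwards [hZ.eventually_mdiffAt_section, hZ'.eventually_mdiffAt_section] with y h2 h3
      simp [leviCivita_add h2 h3]
      rfl
    simp only [curvatureField, h1 hX, h1 hY, leviCivita_add hZ.mdiffAt_section hZ'.mdiffAt_section]
    simp
    abel
  · intro f Z hf hZ
    have hf' := hf.mdifferentiableAt (n := ∞) (by simp)
    have hfd : ∀ᶠ y in 𝓝 x, MDiffAt f y :=
      (contMDiffAt_iff_contMDiffAt_nhds (n := 1) (by simp)).1 (hf.of_le (by simp)) |>.mono
        fun _ h ↦ h.mdifferentiableAt one_ne_zero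
    have h1 {X : Π x : M, TangentSpace I x} (hX : CMDiffAt ∞ (T% X) x) :
        leviCivita I M (fun y ↦ leviCivita I M (f • Z) y (X y)) x
          = f x • leviCivita I M (fun y ↦ leviCivita I M Z y (X y)) x
            + (mvfderiv I f x).smulRight (leviCivita I M Z x (X x))
            + (mvfderiv I f x (X x) • leviCivita I M Z x
              + (mvfderiv I (fun y ↦ mvfderiv I f y (X y)) x).smulRight (Z x)) := by
      have h2 := contMDiffAt_leviCivita hX hZ
      have h3 := contMDiffAt_mvfderiv_apply hf hX
      rw [← leviCivita_smul hf' h2.mdiffAt_section,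
        ← leviCivita_smul (h3.mdifferentiableAt (by simp)) hZ.mdiffAt_section,
        ← leviCivita_add (hf.smul_section h2).mdiffAt_section (h3.smul_section hZ).mdiffAt_section]
      refine leviCivita_congr (contMDiffAt_leviCivita hX (hf.smul_section hZ)).mdiffAt_section
        ((hf.smul_section h2).add_section (h3.smul_section hZ)).mdiffAt_section ?_
      filter_upwards [hfd, hZ.eventually_mdiffAt_section] with y h4 h5
      simp [leviCivita_smul h4 h5]
      rfl
    simp only [curvatureField, h1 hX, h1 hY, leviCivita_smul hf' hZ.mdiffAt_section]
    simp [mvfderiv_mlieBracket hf hX hY]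
    module

theorem curvature_eq_curvatureField {X Y Z : Π x : M, TangentSpace I x} {x : M}
    (hX : CMDiffAt ∞ (T% X) x) (hY : CMDiffAt ∞ (T% Y) x) (hZ : CMDiffAt ∞ (T% Z) x) :
    curvature x (X x) (Y x) (Z x) = curvatureField X Y Z x := by
  have hX' := contMDiffAt_extend (k := ∞) I E (X x)
  have hY' := contMDiffAt_extend (k := ∞) I E (Y x)
  have hZ' := contMDiffAt_extend (k := ∞) I E (Z x)
  rw [curvature, curvatureField_congr_left hX' hX hZ' (by simp), curvatureField_swap,
    curvatureField_congr_left hY' hY hZ' (by simp), ← curvatureField_swap,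
    curvatureField_congr_right hX hY hZ' hZ (by simp)]

/-! ### The Ricci identity for `(1,1)`-tensors -/

section Ricci

variable {S : Π x : M, TangentSpace I x →L[ℝ] TangentSpace I x}

theorem covDerivEnd_apply {V : Π x : M, TangentSpace I x} {x : M} (hS : MDiffEndAt S x)
    (hV : MDiffAt (T% V) x) (u : TangentSpace I x) :
    covDerivEnd S x u (V x) = leviCivita I M (fun y ↦ S y (V y)) x u - S x (leviCivita I M V x u) := by
  rw [covDerivEnd, dif_pos hS, ContinuousLinearMap.flip_apply,
    TensorialAt.mkHom_apply (covDerivEnd_tensorial hS) hV]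
  rfl

theorem SmoothEnd.mdiffEndAt (hS : SmoothEnd S) (x : M) : MDiffEndAt S x :=
  (hS x).mdifferentiableAt (by simp)

theorem SmoothEnd.contMDiffAt_apply (hS : SmoothEnd S) {V : Π x : M, TangentSpace I x} {x : M}
    (hV : CMDiffAt ∞ (T% V) x) : CMDiffAt ∞ (T% (fun y ↦ S y (V y))) x :=
  (hS x).clm_bundle_apply hV

theorem SmoothEnd.covDerivEnd_eventuallyEq (hS : SmoothEnd S) {V : Π x : M, TangentSpace I x}
    {x : M} (U : Π x : M, TangentSpace I x) (hV : CMDiffAt ∞ (T% V) x) :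
    (fun y ↦ covDerivEnd S y (U y) (V y)) =ᶠ[𝓝 x]
      (fun y ↦ leviCivita I M (fun y ↦ S y (V y)) y (U y))
        - fun y ↦ S y (leviCivita I M V y (U y)) := by
  filter_upwards [hV.eventually_mdiffAt_section] with y h
  exact covDerivEnd_apply (hS.mdiffEndAt y) h _

theorem SmoothEnd.contMDiffAt_covDerivEnd (hS : SmoothEnd S) {U V : Π x : M, TangentSpace I x}
    {x : M} (hU : CMDiffAt ∞ (T% U) x) (hV : CMDiffAt ∞ (T% V) x) :
    CMDiffAt ∞ (T% (fun y ↦ covDerivEnd S y (U y) (V y))) x := by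
  have h := (contMDiffAt_leviCivita hU (hS.contMDiffAt_apply hV)).sub_section
    (hS.contMDiffAt_apply (contMDiffAt_leviCivita hU hV))
  refine h.congr_of_eventuallyEq ?_
  filter_upwards [hS.covDerivEnd_eventuallyEq U hV] with y hy
  exact congrArg (TotalSpace.mk' E y) hy

theorem SmoothEnd.leviCivita_covDerivEnd_sub (hS : SmoothEnd S) {X Y Z : Π x : M, TangentSpace I x}
    {x : M} (hX : CMDiffAt ∞ (T% X) x) (hY : CMDiffAt ∞ (T% Y) x) (hZ : CMDiffAt ∞ (T% Z) x) :
    leviCivita I M (fun y ↦ covDerivEnd S y (Y y) (Z y)) x (X x)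
      - leviCivita I M (fun y ↦ covDerivEnd S y (X y) (Z y)) x (Y x)
      = tensorRS S x (X x) (Y x) (Z x)
        + covDerivEnd S x (leviCivita I M Y x (X x) - leviCivita I M X x (Y x)) (Z x)
        + covDerivEnd S x (Y x) (leviCivita I M Z x (X x))
        - covDerivEnd S x (X x) (leviCivita I M Z x (Y x)) := by
  have key {X Y : Π x : M, TangentSpace I x} (hX : CMDiffAt ∞ (T% X) x)
      (hY : CMDiffAt ∞ (T% Y) x) : leviCivita I M (fun y ↦ covDerivEnd S y (Y y) (Z y)) x (X x)
      = leviCivita I M (fun y ↦ leviCivita I M (fun y ↦ S y (Z y)) y (Y y)) x (X x)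
        - (covDerivEnd S x (X x) (leviCivita I M Z x (Y x))
          + S x (leviCivita I M (fun y ↦ leviCivita I M Z y (Y y)) x (X x))) := by
    have h1 := contMDiffAt_leviCivita hY (hS.contMDiffAt_apply hZ)
    have h2 := contMDiffAt_leviCivita hY hZ
    have h3 := hS.contMDiffAt_apply h2
    rw [covDerivEnd_apply (V := fun y ↦ leviCivita I M Z y (Y y)) (hS.mdiffEndAt x)
        h2.mdiffAt_section, sub_add_cancel, leviCivita_congr
        (hS.contMDiffAt_covDerivEnd hY hZ).mdiffAt_section (h1.sub_section h3).mdiffAt_section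
        (hS.covDerivEnd_eventuallyEq Y hZ), eq_sub_iff_add_eq, ← add_apply,
      ← leviCivita_add (h1.sub_section h3).mdiffAt_section h3.mdiffAt_section, sub_add_cancel]
  rw [key hX hY, key hY hX, tensorRS, curvature_eq_curvatureField hX hY hZ,
    curvature_eq_curvatureField (Z := fun y ↦ S y (Z y)) hX hY (hS.contMDiffAt_apply hZ),
    ← mlieBracket_eq_leviCivita_sub hX.mdiffAt_section hY.mdiffAt_section,
    covDerivEnd_apply (hS.mdiffEndAt x) hZ.mdiffAt_section (mlieBracket I X Y x)]
  simp only [curvatureField, map_sub]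
  abel

end Ricci

/-! ### Linear algebra in an orthonormal basis -/

section Algebra

variable {V : Type*} [NormedAddCommGroup V] [InnerProductSpace ℝ V] {ι ι' : Type*} [Fintype ι]
  [Fintype ι']

theorem _root_.OrthonormalBasis.sum_bilin_eq {W : Type*} [AddCommGroup W] [Module ℝ W]
    (e : OrthonormalBasis ι ℝ V) (e' : OrthonormalBasis ι' ℝ V) (B : V →ₗ[ℝ] V →ₗ[ℝ] W) :
    ∑ i, B (e i) (e i) = ∑ j, B (e' j) (e' j) := by
  calc ∑ i, B (e i) (e i) = ∑ i, ∑ j, inner ℝ (e' j) (e i) • B (e' j) (e i) := by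
        refine Finset.sum_congr rfl fun i _ ↦ ?_
        simpa only [map_sum, map_smul, LinearMap.sum_apply, LinearMap.smul_apply] using
          congrArg (fun v ↦ B v (e i)) (e'.sum_repr' (e i)).symm
    _ = ∑ j, ∑ i, inner ℝ (e i) (e' j) • B (e' j) (e i) := by
        rw [Finset.sum_comm]
        simp only [real_inner_comm]
    _ = ∑ j, B (e' j) (e' j) := by
        refine Finset.sum_congr rfl fun j _ ↦ ?_
        simpa only [map_sum, map_smul] using congrArg (B (e' j)) (e.sum_repr' (e' j))

theorem _root_.OrthonormalBasis.sum_bilin_skew (e : OrthonormalBasis ι ℝ V) (G : ι → V)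
    (hG : ∀ i k, inner ℝ (G i) (e k) = -inner ℝ (e i) (G k)) (B : V →ₗ[ℝ] V →ₗ[ℝ] ℝ) :
    ∑ i, B (e i) (G i) = -∑ i, B (G i) (e i) := by
  have h1 : ∑ i, B (e i) (G i) = ∑ i, ∑ k, inner ℝ (e k) (G i) * B (e i) (e k) := by
    refine Finset.sum_congr rfl fun i _ ↦ ?_
    conv_lhs => rw [← e.sum_repr' (G i)]
    simp
  have h2 : ∑ i, B (G i) (e i) = ∑ i, ∑ k, inner ℝ (e k) (G i) * B (e k) (e i) := by
    refine Finset.sum_congr rfl fun i _ ↦ ?_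
    conv_lhs => rw [← e.sum_repr' (G i)]
    simp
  rw [h1, h2, Finset.sum_comm, ← Finset.sum_neg_distrib]
  refine Finset.sum_congr rfl fun i _ ↦ ?_
  rw [← Finset.sum_neg_distrib]
  refine Finset.sum_congr rfl fun k _ ↦ ?_
  rw [real_inner_comm, hG, neg_mul]

theorem sum_divergence_eq (e : OrthonormalBasis ι ℝ V) (S : V →ₗ[ℝ] V) (P : V →ₗ[ℝ] V →ₗ[ℝ] V)
    (G : ι → ι → V) (N R : ι → ι → ι → V)
    (hG : ∀ j i k, inner ℝ (G j i) (e k) = -inner ℝ (e i) (G j k))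
    (hN : ∀ j i k, N j i k - N i j k
      = R j i k + P (G j i - G i j) (e k) + P (e i) (G j k) - P (e j) (G i k)) :
    ∑ j, (∑ i, (inner ℝ (N j i i) (S (e j)) + inner ℝ (P (e i) (e i)) (P (e j) (e j) + S (G j j))
        - (inner ℝ (N j i j) (S (e i)) + inner ℝ (P (e i) (e j)) (P (e j) (e i) + S (G j i))))
        - ∑ i, (inner ℝ (P (e i) (e i)) (S (G j j)) - inner ℝ (P (e i) (G j j)) (S (e i))))
      = ∑ j, inner ℝ (-∑ i, R i j i) (S (e j)) + ‖∑ i, P (e i) (e i)‖ ^ 2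
        - ∑ i, ∑ j, ‖P (e i) (e j)‖ ^ 2
        + 1 / 2 * ∑ i, ∑ j, ‖P (e i) (e j) - P (e j) (e i)‖ ^ 2 := by
  have hR : ∀ j i, R i j i = N i j i - N j i i - P (G i j) (e i) + P (G j i) (e i)
      - P (e j) (G i i) + P (e i) (G j i) := by
    intro j i
    rw [hN i j i, map_sub, LinearMap.sub_apply]
    abel
  have a1 : ∑ j, ∑ i, inner ℝ (N j i j) (S (e i)) = ∑ j, ∑ i, inner ℝ (N i j i) (S (e j)) :=
    Finset.sum_comm
  have a2 : ∑ j, ∑ i, inner ℝ (P (e i) (G j j)) (S (e i))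
      = ∑ j, ∑ i, inner ℝ (P (e j) (G i i)) (S (e j)) := Finset.sum_comm
  have a3 : ∑ j, ∑ i, inner ℝ (P (e i) (G j i)) (S (e j))
      = -∑ j, ∑ i, inner ℝ (P (G j i) (e i)) (S (e j)) := by
    rw [← Finset.sum_neg_distrib]
    exact Finset.sum_congr rfl fun j _ ↦ e.sum_bilin_skew (G j) (hG j)
      (P.compr₂ ((innerₗ V).flip (S (e j))))
  have a4 : ∑ j, ∑ i, inner ℝ (P (e i) (e j)) (S (G j i))
      = -∑ j, ∑ i, inner ℝ (P (G i j) (e i)) (S (e j)) := by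
    rw [Finset.sum_comm (f := fun j i ↦ inner ℝ (P (G i j) (e i)) (S (e j))),
      ← Finset.sum_neg_distrib]
    exact Finset.sum_congr rfl fun j _ ↦ e.sum_bilin_skew (G j) (hG j)
      ((innerₗ V).compl₁₂ (P.flip (e j)) S)
  have a5 : ‖∑ i, P (e i) (e i)‖ ^ 2 = ∑ j, ∑ i, inner ℝ (P (e i) (e i)) (P (e j) (e j)) := by
    rw [← real_inner_self_eq_norm_sq, inner_sum]
    simp only [sum_inner]
  have a6 : ∑ i, ∑ j, ‖P (e i) (e j) - P (e j) (e i)‖ ^ 2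
      = ∑ i, ∑ j, ‖P (e i) (e j)‖ ^ 2 + ∑ i, ∑ j, ‖P (e i) (e j)‖ ^ 2
        - 2 * ∑ j, ∑ i, inner ℝ (P (e i) (e j)) (P (e j) (e i)) := by
    conv_rhs => rw [Finset.sum_comm (f := fun j i ↦ inner ℝ (P (e i) (e j)) (P (e j) (e i)))]
    nth_rw 3 [Finset.sum_comm]
    simp only [norm_sub_sq_real, Finset.mul_sum, ← Finset.sum_add_distrib, ← Finset.sum_sub_distrib]
    exact Finset.sum_congr rfl fun i _ ↦ Finset.sum_congr rfl fun j _ ↦ by ring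
  rw [a5, a6]
  simp only [hR, inner_neg_left, sum_inner, inner_add_left, inner_sub_left, inner_add_right,
    Finset.sum_add_distrib, Finset.sum_sub_distrib, Finset.sum_neg_distrib] at *
  linarith

end Algebra

/-! ### The `1`-form `θ` and its divergence -/

section Theta

variable {S : Π x : M, TangentSpace I x →L[ℝ] TangentSpace I x}

theorem theta_apply_frame (S : Π x : M, TangentSpace I x →L[ℝ] TangentSpace I x) (x : M)
    (u : TangentSpace I x) :
    theta S x u = ∑ i, (inner ℝ (covDerivEnd S x (frame I x i) (frame I x i)) (S x u)
      - inner ℝ (covDerivEnd S x (frame I x i) u) (S x (frame I x i))) := by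
  change ∑ i, ∑ j, ∑ k, (tensorQ x ∘ sigma24) (frame I x i, frame I x j, frame I x k, u)
    * inner ℝ (covDerivEnd S x (frame I x i) (frame I x j)) (S x (frame I x k)) = _
  have hu := (frame I x).sum_repr' u
  refine Finset.sum_congr rfl fun i _ ↦ ?_
  have h1 : inner ℝ (covDerivEnd S x (frame I x i) (frame I x i)) (S x u)
      = ∑ k, inner ℝ (frame I x k) u
        * inner ℝ (covDerivEnd S x (frame I x i) (frame I x i)) (S x (frame I x k)) := by
    conv_lhs => rw [← hu]
    simp [inner_sum, inner_smul_right]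
  have h2 : inner ℝ (covDerivEnd S x (frame I x i) u) (S x (frame I x i))
      = ∑ j, inner ℝ (frame I x j) u
        * inner ℝ (covDerivEnd S x (frame I x i) (frame I x j)) (S x (frame I x i)) := by
    conv_lhs => rw [← hu]
    simp [sum_inner, inner_smul_left]
  rw [h1, h2]
  simp only [Function.comp, sigma24, tensorQ, sub_mul, Finset.sum_sub_distrib,
    (frame I x).inner_eq_ite, real_inner_comm u]
  simp

theorem theta_apply {ι : Type*} [Fintype ι] {x : M} (B : OrthonormalBasis ι ℝ (TangentSpace I x))
    (u : TangentSpace I x) :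
    theta S x u = ∑ i, (inner ℝ (covDerivEnd S x (B i) (B i)) (S x u)
      - inner ℝ (covDerivEnd S x (B i) u) (S x (B i))) := by
  rw [theta_apply_frame]
  exact (frame I x).sum_bilin_eq B (LinearMap.mk₂ ℝ
    (fun v w ↦ inner ℝ (covDerivEnd S x v w) (S x u) - inner ℝ (covDerivEnd S x v u) (S x w))
    (fun v v' w ↦ by simp [inner_add_left]; ring)
    (fun c v w ↦ by simp [inner_smul_left]; ring)
    (fun v w w' ↦ by simp [inner_add_left, inner_add_right]; ring)
    (fun c v w ↦ by simp [inner_smul_left, inner_smul_right]; ring))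

variable {ι : Type*} [Fintype ι] {b : ι → Π x : M, TangentSpace I x} {x : M}

theorem IsOrthonormalFrameAt.theta_eventuallyEq (hb : IsOrthonormalFrameAt b x)
    (V : Π x : M, TangentSpace I x) :
    (fun y ↦ theta S y (V y)) =ᶠ[𝓝 x] fun y ↦
      ∑ i, (inner ℝ (covDerivEnd S y (b i y) (b i y)) (S y (V y))
        - inner ℝ (covDerivEnd S y (b i y) (V y)) (S y (b i y))) := by
  filter_upwards [hb.exists_basis] with y ⟨B, hB⟩
  simp only [theta_apply B, hB]

theorem contMDiffAt_theta_apply (hS : SmoothEnd S) {V : Π x : M, TangentSpace I x} {x : M}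
    (hV : CMDiffAt ∞ (T% V) x) : CMDiffAt ∞ (fun y ↦ theta S y (V y)) x := by
  obtain ⟨b, hb, -⟩ := exists_isOrthonormalFrameAt (I := I) x
  refine ContMDiffAt.congr_of_eventuallyEq ?_ (hb.theta_eventuallyEq V)
  refine contMDiffAt_finsetSum fun i _ ↦ ?_
  have hi := hb.contMDiffAt i
  exact (contMDiffAt_inner (hS.contMDiffAt_covDerivEnd hi hi) (hS.contMDiffAt_apply hV)).sub
    (contMDiffAt_inner (hS.contMDiffAt_covDerivEnd hi hV) (hS.contMDiffAt_apply hi))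

theorem contMDiffAt_form_of_apply {θ : Π x : M, TangentSpace I x →L[ℝ] ℝ} {x : M}
    (h : ∀ V : Π x : M, TangentSpace I x, CMDiffAt ∞ (T% V) x →
      CMDiffAt ∞ (fun y ↦ θ y (V y)) x) :
    ContMDiffAt I (I.prod 𝓘(ℝ, E →L[ℝ] ℝ)) ∞
      (fun y ↦ TotalSpace.mk' (E →L[ℝ] ℝ) (E := fun y : M ↦ TangentSpace I y →L[ℝ] ℝ) y (θ y))
      x := by
  obtain ⟨b, hb, -⟩ := exists_isOrthonormalFrameAt (I := I) x
  obtain ⟨g, hg, hgi⟩ := IsContMDiffRiemannianBundle.exists_contMDiff (IB := I) (n := ∞) (F := E)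
    (E := fun x : M ↦ TangentSpace I x)
  have hgb (i) : ContMDiffAt I (I.prod 𝓘(ℝ, E →L[ℝ] ℝ)) ∞
      (fun y ↦ TotalSpace.mk' (E →L[ℝ] ℝ) (E := fun y : M ↦ TangentSpace I y →L[ℝ] ℝ) y
        (g y (b i y))) x :=
    ContMDiffAt.clm_bundle_apply (F₁ := E) (E₁ := fun y : M ↦ TangentSpace I y)
      (F₂ := E →L[ℝ] ℝ) (E₂ := fun y : M ↦ TangentSpace I y →L[ℝ] Bundle.Trivial M ℝ y)
      (hg x) (hb.contMDiffAt i)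
  have hsum := ContMDiffAt.sum_section (F := E →L[ℝ] ℝ)
    (V := fun y : M ↦ TangentSpace I y →L[ℝ] Bundle.Trivial M ℝ y) (s := Finset.univ)
    (t := fun i y ↦ θ y (b i y) • g y (b i y))
    fun i _ ↦ (h (b i) (hb.contMDiffAt i)).smul_section (hgb i)
  refine hsum.congr_of_eventuallyEq ?_
  filter_upwards [hb.exists_basis] with y ⟨B, hB⟩
  refine congrArg (TotalSpace.mk' (E →L[ℝ] ℝ) y) (ContinuousLinearMap.ext fun u ↦ ?_)
  have hu : θ y u = ∑ i, θ y (b i y) * inner ℝ (b i y) u := by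
    conv_lhs => rw [← B.sum_repr' u]
    simp [hB, mul_comm]
  refine hu.trans ?_
  change _ = (∑ i, θ y (b i y) • g y (b i y) : TangentSpace I y →L[ℝ] ℝ) u
  simp [hgi]

theorem smoothForm_theta (hS : SmoothEnd S) : SmoothForm (theta S) := fun _ ↦
  contMDiffAt_form_of_apply fun _ hV ↦ contMDiffAt_theta_apply hS hV

theorem covDerivForm_apply {θ : Π x : M, TangentSpace I x →L[ℝ] ℝ} {V : Π x : M, TangentSpace I x}
    {x : M} (hθ : MDiffFormAt θ x) (hV : MDiffAt (T% V) x) (u : TangentSpace I x) :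
    covDerivForm θ x u (V x)
      = mvfderiv I (fun y ↦ θ y (V y)) x u - θ x (leviCivita I M V x u) := by
  rw [covDerivForm, dif_pos hθ, ContinuousLinearMap.flip_apply,
    TensorialAt.mkHom_apply (covDerivForm_tensorial hθ) hV]
  rfl

theorem mvfderiv_congr {f g : M → ℝ} (h : f =ᶠ[𝓝 x] g) : mvfderiv I f x = mvfderiv I g x := by
  unfold mvfderiv
  rw [h.mfderiv_eq]
  rfl

theorem mvfderiv_finsetSum {f : ι → M → ℝ} (s : Finset ι) (hf : ∀ i, MDiffAt (f i) x) :
    mvfderiv I (fun y ↦ ∑ i ∈ s, f i y) x = ∑ i ∈ s, mvfderiv I (f i) x := by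
  classical
  have h : MDiffAt (fun y ↦ ∑ i ∈ s, f i y) x ∧
      mvfderiv I (fun y ↦ ∑ i ∈ s, f i y) x = ∑ i ∈ s, mvfderiv I (f i) x := by
    induction s using Finset.induction_on with
    | empty => exact ⟨by simpa using mdifferentiableAt_const, by simpa using mvfderiv_const 0⟩
    | insert a s ha ih =>
      simp only [Finset.sum_insert ha]
      exact ⟨(hf a).add ih.1, by rw [mvfderiv_fun_add (hf a) ih.1, ih.2]⟩
  exact h.2

theorem IsOrthonormalFrameAt.mvfderiv_theta (hb : IsOrthonormalFrameAt b x) (hS : SmoothEnd S)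
    {U V : Π x : M, TangentSpace I x} (hU : CMDiffAt ∞ (T% U) x) (hV : CMDiffAt ∞ (T% V) x) :
    mvfderiv I (fun y ↦ theta S y (V y)) x (U x)
      = ∑ i, (inner ℝ (leviCivita I M (fun y ↦ covDerivEnd S y (b i y) (b i y)) x (U x))
            (S x (V x))
          + inner ℝ (covDerivEnd S x (b i x) (b i x))
            (covDerivEnd S x (U x) (V x) + S x (leviCivita I M V x (U x)))
        - (inner ℝ (leviCivita I M (fun y ↦ covDerivEnd S y (b i y) (V y)) x (U x))
            (S x (b i x))
          + inner ℝ (covDerivEnd S x (b i x) (V x))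
            (covDerivEnd S x (U x) (b i x) + S x (leviCivita I M (b i) x (U x))))) := by
  have hP {X Y : Π x : M, TangentSpace I x} (hX : CMDiffAt ∞ (T% X) x)
      (hY : CMDiffAt ∞ (T% Y) x) := (hS.contMDiffAt_covDerivEnd hX hY).mdiffAt_section
  have hSm {X : Π x : M, TangentSpace I x} (hX : CMDiffAt ∞ (T% X) x) :=
    (hS.contMDiffAt_apply hX).mdiffAt_section
  have hbi := hb.contMDiffAt
  have hd {X : Π x : M, TangentSpace I x} (hX : CMDiffAt ∞ (T% X) x) :
      leviCivita I M (fun y ↦ S y (X y)) x (U x)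
        = covDerivEnd S x (U x) (X x) + S x (leviCivita I M X x (U x)) := by
    rw [covDerivEnd_apply (hS.mdiffEndAt x) hX.mdiffAt_section, sub_add_cancel]
  have hin {X Y : Π x : M, TangentSpace I x} (hX : MDiffAt (T% X) x) (hY : MDiffAt (T% Y) x) :=
    leviCivita_metric hU.mdiffAt_section hX hY
  have h1 (i) := mdiffAt_inner (hP (hbi i) (hbi i)) (hSm hV)
  have h2 (i) := mdiffAt_inner (hP (hbi i) hV) (hSm (hbi i))
  have h3 (i) : MDiffAt (fun y ↦ inner ℝ (covDerivEnd S y (b i y) (b i y)) (S y (V y))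
      - inner ℝ (covDerivEnd S y (b i y) (V y)) (S y (b i y))) x := (h1 i).sub (h2 i)
  rw [mvfderiv_congr (hb.theta_eventuallyEq V), mvfderiv_finsetSum _ h3, sum_apply]
  refine Finset.sum_congr rfl fun i _ ↦ ?_
  rw [mvfderiv_fun_sub (h1 i) (h2 i), sub_apply, hin (hP (hbi i) (hbi i)) (hSm hV),
    hin (hP (hbi i) hV) (hSm (hbi i)), hd hV, hd (hbi i)]

theorem divForm_theta (hS : SmoothEnd S) (x : M) :
    divForm (theta S) x = inner₁ x (tensorT S x) (S x) + ‖divEnd S x‖ ^ 2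
      - normSq₂ x (fun u v ↦ covDerivEnd S x u v) + 1 / 2 * normSq₂ x (tensorW S x) := by
  obtain ⟨b, hb, hbx⟩ := exists_isOrthonormalFrameAt (I := I) x
  have hbi := hb.contMDiffAt
  have hbd (i) : MDiffAt (T% (b i)) x := (hbi i).mdiffAt_section
  have hG (j i k) : inner ℝ (leviCivita I M (b i) x (b j x)) (frame I x k)
      = -inner ℝ (frame I x i) (leviCivita I M (b k) x (b j x)) := by
    rw [← hbx, ← hbx, ← add_eq_zero_iff_eq_neg, ← leviCivita_metric (hbd j) (hbd i) (hbd k)]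
    have h : (fun y ↦ inner ℝ (b i y) (b k y)) =ᶠ[𝓝 x] fun _ ↦ if i = k then (1 : ℝ) else 0 := by
      filter_upwards [hb.exists_basis] with y ⟨B, hB⟩
      rw [← hB, ← hB, B.inner_eq_ite]
    rw [mvfderiv_congr h, mvfderiv_const, zero_apply]
  have key := sum_divergence_eq (frame I x) (S x : TangentSpace I x →ₗ[ℝ] TangentSpace I x)
    (LinearMap.mk₂ ℝ (fun u v ↦ covDerivEnd S x u v) (by simp) (by simp) (by simp) (by simp))
    (fun j i ↦ leviCivita I M (b i) x (b j x))
    (fun j i k ↦ leviCivita I M (fun y ↦ covDerivEnd S y (b i y) (b k y)) x (b j x))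
    (fun j i k ↦ tensorRS S x (b j x) (b i x) (b k x)) hG
    (fun j i k ↦ by
      simpa [hbx] using hS.leviCivita_covDerivEnd_sub (hbi j) (hbi i) (hbi k))
  simp only [LinearMap.mk₂_apply, ContinuousLinearMap.coe_coe, hbx] at key
  rw [divForm, inner₁, divEnd, normSq₂, normSq₂]
  simp only [tensorW, tensorT]
  rw [← key]
  refine Finset.sum_congr rfl fun j _ ↦ ?_
  have hj := covDerivForm_apply ((smoothForm_theta hS x).mdifferentiableAt (by simp)) (hbd j)
    (b j x)
  rw [hb.mvfderiv_theta hS (hbi j) (hbi j), theta_apply_frame] at hj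
  simpa only [hbx] using hj

end Theta

end RiemannianBochner

end

theorem mainTheorem4
    {E : Type*} [NormedAddCommGroup E] [NormedSpace ℝ E] [FiniteDimensional ℝ E]
    {H : Type*} [TopologicalSpace H] {I : ModelWithCorners ℝ E H}
    {M : Type*} [TopologicalSpace M] [ChartedSpace H M] [IsManifold I ∞ M]
    [BoundarylessManifold I M]
    [RiemannianBundle (fun x : M ↦ TangentSpace I x)]
    [IsContMDiffRiemannianBundle I ∞ E (fun x : M ↦ TangentSpace I x)]
    (S : Π x : M, TangentSpace I x →L[ℝ] TangentSpace I x)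
    (hS : RiemannianBochner.SmoothEnd S)
    (hSymm : ∀ (x : M) (u v : TangentSpace I x), inner ℝ (S x u) v = inner ℝ u (S x v)) :
    RiemannianBochner.SmoothForm (RiemannianBochner.theta S) ∧
    ∀ x : M,
      RiemannianBochner.divForm (RiemannianBochner.theta S) x
        = RiemannianBochner.inner₁ x (RiemannianBochner.tensorT S x) (S x)
          + ‖RiemannianBochner.divEnd S x‖ ^ 2
          - RiemannianBochner.normSq₂ x (fun u v ↦ RiemannianBochner.covDerivEnd S x u v)
          + 1 / 2 * RiemannianBochner.normSq₂ x (RiemannianBochner.tensorW S x) :=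
  ⟨RiemannianBochner.smoothForm_theta hS, RiemannianBochner.divForm_theta hS⟩
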